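/- Let $\mathbf t = 0110100110010110\cdots$ be the Thue--Morse word, i.e., the fixed point starting with $0$ of the substitution $0\mapsto 01$, $1\mapsto 10$. An abelian square of order $n$ is a nonempty word of length $2n$ of the form $uv$, where each letter occurs equally often in $u$ and in $v$. Let $f(n)$ denote the number of distinct abelian squares of order $n$ that occur as factors (contiguous blocks) of $\mathbf t$. Then for every integer $n\ge 1$, $$f(4^n-1)=\frac{4^{n+1}-4}{3}\qquad\text{and}\qquad f(3\cdot 2^n)=14\cdot 2^n-4 .$$ -/

import Mathlib

namespace AbelianSquares

variable {α : Type*}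

/-- The Parikh vector of a finite word: the number of occurrences of each letter. -/
def parikh [DecidableEq α] (w : List α) : α → ℕ := fun a => w.count a

/-- An abelian square: a nonempty word `u ++ v` with `u` and `v` of equal Parikh vector. -/
def IsAbelianSquare [DecidableEq α] (w : List α) : Prop :=
  w ≠ [] ∧ ∃ u v : List α, w = u ++ v ∧ parikh u = parikh v

/-- The word of length `n` that occurs at position `i` of the infinite word `x`. -/
def window (x : ℕ → α) (i n : ℕ) : List α := (List.range n).map fun k => x (i + k)

/-- A finite word is a factor of the infinite word `x` if it occurs at some position of `x`. -/
def IsFactor (w : List α) (x : ℕ → α) : Prop := ∃ i : ℕ, w = window x i w.length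

/-- The extension of a substitution to finite words, as a morphism for concatenation. -/
def applySubst (τ : α → List α) (w : List α) : List α := w.flatMap τ

/-- The infinite word `x` is a fixed point of the substitution `τ`:
the image of each prefix of `x` is a prefix of `x`. -/
def IsFixedPoint (τ : α → List α) (x : ℕ → α) : Prop :=
  ∀ n : ℕ, applySubst τ (window x 0 n) = window x 0 (applySubst τ (window x 0 n)).length

/-- The Thue-Morse substitution `0 ↦ 01`, `1 ↦ 10`. -/
def mu : Fin 2 → List (Fin 2) := ![[0, 1], [1, 0]]

/-- The Thue-Morse word, the limit of the words obtained by iterating the substitution on `0`: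
its letter at position `i` is read off the `i`-th iterate, a word of length `2 ^ i > i`. -/
def thueMorse (i : ℕ) : Fin 2 := ((applySubst mu)^[i] [0]).getD i 0

/-- The set of abelian squares of order `n` (length `2 * n`) that are factors of `x`. -/
def abelianSquareFactors [DecidableEq α] (x : ℕ → α) (n : ℕ) : Set (List α) :=
  {w | IsFactor w x ∧ IsAbelianSquare w ∧ w.length = 2 * n}

/-- The number of distinct abelian squares of order `n` in the Thue-Morse word. -/
noncomputable def f (n : ℕ) : ℕ := (abelianSquareFactors thueMorse n).ncard

/-! The word `thueMorse` is the fixed point of `mu` that starts with `0`. -/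

theorem length_applySubst_mu (w : List (Fin 2)) : (applySubst mu w).length = 2 * w.length := by
  induction w with
  | nil => rfl
  | cons a w ih =>
    simp only [applySubst, List.flatMap_cons, List.length_append, List.length_cons] at ih ⊢
    have : (mu a).length = 2 := by fin_cases a <;> rfl
    omega

theorem length_iterate (k : ℕ) : ((applySubst mu)^[k] [0]).length = 2 ^ k := by
  induction k with
  | zero => rfl
  | succ k ih => rw [Function.iterate_succ_apply', length_applySubst_mu, ih, pow_succ, mul_comm]

theorem iterate_prefix_succ (k : ℕ) :
    (applySubst mu)^[k] [0] <+: (applySubst mu)^[k + 1] [0] := by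
  induction k with
  | zero => exact ⟨[1], rfl⟩
  | succ k ih =>
    rw [Function.iterate_succ_apply', Function.iterate_succ_apply']
    obtain ⟨s, hs⟩ := ih
    exact ⟨applySubst mu s, by rw [← hs]; simp [applySubst]⟩

theorem iterate_prefix {k l : ℕ} (h : k ≤ l) :
    (applySubst mu)^[k] [0] <+: (applySubst mu)^[l] [0] := by
  induction l, h using Nat.le_induction with
  | base => exact List.prefix_rfl
  | succ l _ ih => exact ih.trans (iterate_prefix_succ l)

theorem iterate_eq_window (k : ℕ) :
    (applySubst mu)^[k] [0] = window thueMorse 0 (2 ^ k) := by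
  apply List.ext_getElem
  · simp [length_iterate, window]
  · intro i h1 h2
    have hi : i < ((applySubst mu)^[i] [0]).length := by
      rw [length_iterate]; exact Nat.lt_two_pow_self
    simp only [window, List.getElem_map, List.getElem_range, zero_add, thueMorse]
    rw [List.getD_eq_getElem _ _ hi]
    rcases le_total i k with h | h
    · exact ((iterate_prefix h).getElem hi).symm
    · exact (iterate_prefix h).getElem h1

theorem window_prefix (x : ℕ → α) {m n : ℕ} (h : m ≤ n) : window x 0 m <+: window x 0 n := by
  obtain ⟨d, rfl⟩ := Nat.exists_eq_add_of_le h
  exact ⟨(List.range d).map fun k => x (0 + (m + k)), by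
    simp [window, List.range_add, Function.comp_def]⟩

theorem thueMorse_zero : thueMorse 0 = 0 := rfl

theorem thueMorse_isFixedPoint : IsFixedPoint mu thueMorse := by
  intro n
  have h1 : window thueMorse 0 n <+: (applySubst mu)^[n] [0] := by
    rw [iterate_eq_window]; exact window_prefix _ Nat.lt_two_pow_self.le
  have h2 : applySubst mu (window thueMorse 0 n) <+: window thueMorse 0 (2 ^ (n + 1)) := by
    rw [← iterate_eq_window, Function.iterate_succ_apply']
    obtain ⟨s, hs⟩ := h1
    exact ⟨applySubst mu s, by rw [← hs]; simp [applySubst]⟩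
  have hl : (applySubst mu (window thueMorse 0 n)).length ≤ 2 ^ (n + 1) := by
    simpa [window] using h2.length_le
  exact (List.prefix_of_prefix_length_le h2 (window_prefix _ hl)
    (by simp [window])).eq_of_length (by simp [window])

end AbelianSquares

namespace AbelianSquares

/-! Each block `2k, 2k+1` holds exactly one 1, so the number of ones in a prefix is `k` at `2k` and
`k + t k` at `2k + 1`. A window of length `2n` at `i` is an abelian square iff the second difference
of this count, with step `n`, vanishes at `i`. For `n = 2m` it always vanishes at even `i`, and at
`i = 2j + 1` iff `t` agrees at `j, j+m, j+2m`. For odd `n` it never vanishes at even `i`, and at `i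
= 2j + 1` iff `t j ≠ t (j + n)`.

Windows of length at least 4 reveal the parity of their position and desubstitute uniquely, so
counts of windows satisfy halving recurrences (`windowCount_split`). This gives `f_two_mul` and
`f_two_mul_add_one`, and then the recurrences for `complexity`, `eqThree`, `eqEnds` and `neEnds`,
whose base cases are computed on a finite prefix. -/

/-! ### Letter recurrences and desubstitution of windows -/

theorem window_eq_window_iff {α : Type*} {x : ℕ → α} {i j n : ℕ} :
    window x i n = window x j n ↔ ∀ k < n, x (i + k) = x (j + k) := by
  simp [window]

theorem length_window {α : Type*} (x : ℕ → α) (i n : ℕ) : (window x i n).length = n := by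
  simp [window]

theorem window_add {α : Type*} (x : ℕ → α) (i m n : ℕ) :
    window x i (m + n) = window x i m ++ window x (i + m) n := by
  simp [window, List.range_add, Function.comp_def, add_assoc]

theorem applySubst_mu_window (n : ℕ) :
    applySubst mu (window thueMorse 0 n) = window thueMorse 0 (2 * n) := by
  rw [thueMorse_isFixedPoint n, length_applySubst_mu, length_window]

theorem mu_thueMorse (n : ℕ) :
    mu (thueMorse n) = [thueMorse (2 * n), thueMorse (2 * n + 1)] := by
  have h := applySubst_mu_window (n + 1)
  rw [mul_add, window_add, window_add] at h
  have h' : applySubst mu (window thueMorse 0 n ++ window thueMorse (0 + n) 1) =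
      applySubst mu (window thueMorse 0 n) ++ mu (thueMorse n) := by
    simp [applySubst, window]
  rw [h', applySubst_mu_window, List.append_cancel_left_eq] at h
  simpa [window, List.range_succ] using h

theorem thueMorse_two_mul (n : ℕ) : thueMorse (2 * n) = thueMorse n := by
  have h := mu_thueMorse n
  generalize thueMorse n = a at *
  fin_cases a <;> simp_all [mu]

theorem thueMorse_two_mul_add_one (n : ℕ) : thueMorse (2 * n + 1) = 1 - thueMorse n := by
  have h := mu_thueMorse n
  generalize thueMorse n = a, thueMorse (2 * n) = b, thueMorse (2 * n + 1) = c at *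
  revert a b c
  decide

theorem one_sub_inj {a b : Fin 2} : 1 - a = 1 - b ↔ a = b := by
  revert a b; decide

/-- The windows of the Thue-Morse word of length `2 * M` at even positions are determined by
the windows of length `M`. -/
theorem window_even_even (i j M : ℕ) :
    window thueMorse (2 * i) (2 * M) = window thueMorse (2 * j) (2 * M) ↔
      window thueMorse i M = window thueMorse j M := by
  simp only [window_eq_window_iff]
  constructor
  · intro h k hk
    have := h (2 * k) (by omega)
    rwa [← mul_add, ← mul_add, thueMorse_two_mul, thueMorse_two_mul] at this
  · intro h k hk
    obtain ⟨l, rfl | rfl⟩ := k.even_or_odd'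
    · rw [← mul_add, ← mul_add, thueMorse_two_mul, thueMorse_two_mul]
      exact h l (by omega)
    · rw [← add_assoc, ← add_assoc, ← mul_add, ← mul_add, thueMorse_two_mul_add_one,
        thueMorse_two_mul_add_one, h l (by omega)]

/-- The last letter opens a block of `mu` and so determines the missing second letter. -/
theorem window_even_odd (i j M : ℕ) :
    window thueMorse (2 * i) (2 * M + 1) = window thueMorse (2 * j) (2 * M + 1) ↔
      window thueMorse i (M + 1) = window thueMorse j (M + 1) := by
  rw [← window_even_even i j]
  simp only [window_eq_window_iff]
  constructor
  · intro h k hk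
    rcases Nat.lt_or_ge k (2 * M + 1) with hk' | hk'
    · exact h k hk'
    · obtain rfl : k = 2 * M + 1 := by omega
      have := h (2 * M) (by omega)
      rw [← add_assoc, ← add_assoc, ← mul_add, ← mul_add, thueMorse_two_mul_add_one,
        thueMorse_two_mul_add_one, ← thueMorse_two_mul, ← thueMorse_two_mul (j + M),
        mul_add, mul_add, this]
  · intro h k hk
    exact h k (by omega)

theorem window_succ_eq_iff {α : Type*} {x : ℕ → α} {i j n : ℕ} :
    window x i (n + 1) = window x j (n + 1) ↔
      x i = x j ∧ window x (i + 1) n = window x (j + 1) n := by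
  rw [add_comm, window_add, window_add]
  simp [window]

/-- The first letter closes a block, so the letter before it is its complement. -/
theorem window_odd_eq_iff (i j N : ℕ) :
    window thueMorse (2 * i + 1) (N + 1) = window thueMorse (2 * j + 1) (N + 1) ↔
      window thueMorse (2 * i) (N + 2) = window thueMorse (2 * j) (N + 2) := by
  rw [window_succ_eq_iff (n := N + 1), window_succ_eq_iff (n := N), thueMorse_two_mul_add_one,
    thueMorse_two_mul_add_one, one_sub_inj, thueMorse_two_mul, thueMorse_two_mul]
  tauto

theorem window_odd_odd (i j M : ℕ) :
    window thueMorse (2 * i + 1) (2 * M + 1) = window thueMorse (2 * j + 1) (2 * M + 1) ↔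
      window thueMorse i (M + 1) = window thueMorse j (M + 1) := by
  rw [window_odd_eq_iff, ← window_even_even i j, mul_add]

theorem window_odd_even (i j M : ℕ) (hM : 1 ≤ M) :
    window thueMorse (2 * i + 1) (2 * M) = window thueMorse (2 * j + 1) (2 * M) ↔
      window thueMorse i (M + 1) = window thueMorse j (M + 1) := by
  obtain ⟨M, rfl⟩ := Nat.exists_eq_add_of_le' hM
  rw [show 2 * (M + 1) = (2 * M + 1) + 1 by ring, window_odd_eq_iff, ← window_even_odd i j]
  rfl

/-! ### Short factors and the parity of positions -/

theorem thueMorse_eq_getD {i : ℕ} (h : i < 64) :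
    thueMorse i = ((applySubst mu)^[6] [0]).getD i 0 := by
  rw [iterate_eq_window, List.getD_eq_getElem _ _ (by simpa [window] using h)]
  simp [window]

/-- Every window of length at most `9` occurs at one of the first `48` positions. -/
theorem exists_window_eq (i : ℕ) {N : ℕ} (hN : N ≤ 9) :
    ∃ j < 48, window thueMorse i N = window thueMorse j N := by
  -- Desubstitution takes length `M + 1` to `2 * M + 1` and doubles the range of positions: lengths
  -- 2, 3, 5, 9 with ranges 6, 12, 24, 48.
  have step (M K : ℕ)
      (h : ∀ i, ∃ j < K, window thueMorse i (M + 1) = window thueMorse j (M + 1)) (i : ℕ) :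
      ∃ j < 2 * K, window thueMorse i (2 * M + 1) = window thueMorse j (2 * M + 1) := by
    obtain ⟨l, rfl | rfl⟩ := i.even_or_odd' <;> obtain ⟨j, hj, e⟩ := h l
    · exact ⟨2 * j, by omega, (window_even_odd _ _ _).2 e⟩
    · exact ⟨2 * j + 1, by omega, (window_odd_odd _ _ _).2 e⟩
  have two (i : ℕ) : ∃ j < 6, window thueMorse i 2 = window thueMorse j 2 := by
    have h : ∀ a b : Fin 2, ∃ j < 6, a = ((applySubst mu)^[6] [0]).getD j 0 ∧
        b = ((applySubst mu)^[6] [0]).getD (j + 1) 0 := by decide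
    obtain ⟨j, hj, h0, h1⟩ := h (thueMorse i) (thueMorse (i + 1))
    refine ⟨j, hj, ?_⟩
    rw [← thueMorse_eq_getD (by omega)] at h0 h1
    simp [window, List.range_succ, h0, h1]
  obtain ⟨j, hj, h⟩ := step 4 24 (step 2 12 (step 1 6 two)) i
  refine ⟨j, hj, ?_⟩
  rw [window_eq_window_iff] at h ⊢
  exact fun k hk => h k (by omega)

/-- Windows of length at least `4` at an even and at an odd position differ. -/
theorem window_even_ne_odd (i j : ℕ) {N : ℕ} (hN : 4 ≤ N) :
    window thueMorse (2 * i) N ≠ window thueMorse (2 * j + 1) N := by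
  intro h
  rw [window_eq_window_iff] at h
  have h0 := h 0 (by omega)
  have h1 := h 1 (by omega)
  have h2 := h 2 (by omega)
  have h3 := h 3 (by omega)
  -- Agreement on four letters would force `t j = t (j+1) = t (j+2)`, but no letter occurs three
  -- times in a row.
  obtain ⟨l, hl, e⟩ := exists_window_eq j (N := 3) (by omega)
  rw [window_eq_window_iff] at e
  have e0 := e 0 (by omega)
  have e1 := e 1 (by omega)
  have e2 := e 2 (by omega)
  rw [thueMorse_eq_getD (i := l + 0) (by omega)] at e0
  rw [thueMorse_eq_getD (i := l + 1) (by omega)] at e1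
  rw [thueMorse_eq_getD (i := l + 2) (by omega)] at e2
  have cubefree : ∀ l < 48, ¬ (((applySubst mu)^[6] [0]).getD (l + 0) 0 =
      ((applySubst mu)^[6] [0]).getD (l + 1) 0 ∧ ((applySubst mu)^[6] [0]).getD (l + 1) 0 =
      ((applySubst mu)^[6] [0]).getD (l + 2) 0) := by decide +kernel
  apply cubefree l hl
  rw [← e0, ← e1, ← e2]
  simp only [add_zero] at h0 ⊢
  rw [thueMorse_two_mul, thueMorse_two_mul_add_one] at h0
  rw [thueMorse_two_mul_add_one, add_assoc, show 2 * j + (1 + 1) = 2 * (j + 1) by ring,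
    thueMorse_two_mul] at h1
  rw [show 2 * i + 2 = 2 * (i + 1) by ring, show 2 * j + 1 + 2 = 2 * (j + 1) + 1 by ring,
    thueMorse_two_mul, thueMorse_two_mul_add_one] at h2
  rw [show 2 * i + 3 = 2 * (i + 1) + 1 by ring, show 2 * j + 1 + 3 = 2 * (j + 2) by ring,
    thueMorse_two_mul, thueMorse_two_mul_add_one] at h3
  generalize thueMorse j = a at *
  generalize thueMorse (j + 1) = b at *
  generalize thueMorse (j + 2) = c at *
  rw [h0] at h1
  rw [h2] at h3
  clear h0 h2 e0 e1 e2
  revert a b c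
  decide

/-! ### Counting windows by parity of position -/

/-- The number of distinct windows of length `N` of the Thue-Morse word at positions
satisfying `P`. -/
noncomputable def windowCount (N : ℕ) (P : ℕ → Prop) : ℕ :=
  ((fun i => window thueMorse i N) '' {i | P i}).ncard

theorem finite_windows (N : ℕ) (s : Set ℕ) : ((fun i => window thueMorse i N) '' s).Finite := by
  refine (List.finite_length_eq (Fin 2) N).subset ?_
  rintro _ ⟨i, -, rfl⟩
  exact length_window _ _ _

theorem windowCount_congr {N : ℕ} {P Q : ℕ → Prop} (h : ∀ i, P i ↔ Q i) :
    windowCount N P = windowCount N Q := by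
  simp only [windowCount, h]

theorem ncard_image_eq_of_forall_eq_iff {ι α β : Type*} (f : ι → α) (g : ι → β)
    (h : ∀ i j, f i = f j ↔ g i = g j) (s : Set ι) : (f '' s).ncard = (g '' s).ncard := by
  refine Set.ncard_congr (fun a ha => g ha.choose)
    (fun a ha => ⟨_, ha.choose_spec.1, rfl⟩) ?_ ?_
  · intro a b ha hb hab
    rw [← ha.choose_spec.2, ← hb.choose_spec.2]
    exact (h _ _).2 hab
  · rintro _ ⟨i, hi, rfl⟩
    have ha : f i ∈ f '' s := ⟨i, hi, rfl⟩
    exact ⟨f i, ha, (h _ _).1 ha.choose_spec.2⟩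

theorem windowCount_split {N M₀ M₁ : ℕ} (hN : 4 ≤ N)
    (h₀ : ∀ i j, window thueMorse (2 * i) N = window thueMorse (2 * j) N ↔
      window thueMorse i M₀ = window thueMorse j M₀)
    (h₁ : ∀ i j, window thueMorse (2 * i + 1) N = window thueMorse (2 * j + 1) N ↔
      window thueMorse i M₁ = window thueMorse j M₁) (P : ℕ → Prop) :
    windowCount N P =
      windowCount M₀ (fun j => P (2 * j)) + windowCount M₁ (fun j => P (2 * j + 1)) := by
  have hs : (fun i => window thueMorse i N) '' {i | P i} =
      (fun j => window thueMorse (2 * j) N) '' {j | P (2 * j)} ∪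
        (fun j => window thueMorse (2 * j + 1) N) '' {j | P (2 * j + 1)} := by
    ext w
    constructor
    · rintro ⟨i, hi, rfl⟩
      obtain ⟨l, rfl | rfl⟩ := i.even_or_odd'
      · exact Or.inl ⟨l, hi, rfl⟩
      · exact Or.inr ⟨l, hi, rfl⟩
    · rintro (⟨j, hj, rfl⟩ | ⟨j, hj, rfl⟩)
      exacts [⟨2 * j, hj, rfl⟩, ⟨2 * j + 1, hj, rfl⟩]
  have hf := finite_windows N {i | P i}
  rw [hs] at hf
  rw [windowCount, hs, Set.ncard_union_eq ?_ (hf.subset Set.subset_union_left)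
    (hf.subset Set.subset_union_right), ncard_image_eq_of_forall_eq_iff _ _ h₀,
    ncard_image_eq_of_forall_eq_iff _ _ h₁]
  · rfl
  · rw [Set.disjoint_left]
    rintro _ ⟨i, -, rfl⟩ ⟨j, -, h⟩
    exact window_even_ne_odd i j hN h.symm

theorem windowCount_two_mul {M : ℕ} (hM : 2 ≤ M) (P : ℕ → Prop) :
    windowCount (2 * M) P =
      windowCount M (fun j => P (2 * j)) + windowCount (M + 1) (fun j => P (2 * j + 1)) :=
  windowCount_split (by omega) (fun i j => window_even_even i j M)
    (fun i j => window_odd_even i j M (by omega)) P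

theorem windowCount_two_mul_add_one {M : ℕ} (hM : 2 ≤ M) (P : ℕ → Prop) :
    windowCount (2 * M + 1) P =
      windowCount (M + 1) (fun j => P (2 * j)) + windowCount (M + 1) (fun j => P (2 * j + 1)) :=
  windowCount_split (by omega) (fun i j => window_even_odd i j M)
    (fun i j => window_odd_odd i j M) P

/-! Windows whose first and last letters agree or differ. -/

theorem eq_shift_even {d : ℕ} (j : ℕ) :
    thueMorse (2 * j) = thueMorse (2 * j + 2 * d) ↔ thueMorse j = thueMorse (j + d) := by
  rw [← mul_add, thueMorse_two_mul, thueMorse_two_mul]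

theorem eq_shift_odd {d : ℕ} (j : ℕ) :
    thueMorse (2 * j + 1) = thueMorse (2 * j + 1 + 2 * d) ↔
      thueMorse j = thueMorse (j + d) := by
  rw [show 2 * j + 1 + 2 * d = 2 * (j + d) + 1 by ring, thueMorse_two_mul_add_one,
    thueMorse_two_mul_add_one, one_sub_inj]

theorem eq_one_sub_iff {a b : Fin 2} : a = 1 - b ↔ a ≠ b := by
  revert a b; decide

theorem eq_shift_odd_even {d : ℕ} (j : ℕ) :
    thueMorse (2 * j) = thueMorse (2 * j + (2 * d + 1)) ↔
      thueMorse j ≠ thueMorse (j + d) := by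
  rw [show 2 * j + (2 * d + 1) = 2 * (j + d) + 1 by ring, thueMorse_two_mul_add_one,
    thueMorse_two_mul, eq_one_sub_iff]

theorem eq_shift_odd_odd {d : ℕ} (j : ℕ) :
    thueMorse (2 * j + 1) = thueMorse (2 * j + 1 + (2 * d + 1)) ↔
      thueMorse j ≠ thueMorse (j + (d + 1)) := by
  rw [show 2 * j + 1 + (2 * d + 1) = 2 * (j + (d + 1)) by ring, thueMorse_two_mul_add_one,
    thueMorse_two_mul, eq_comm, eq_one_sub_iff, ne_comm]

/-- The number of factors of length `d + 1` with equal first and last letters. -/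
noncomputable def eqEnds (d : ℕ) : ℕ :=
  windowCount (d + 1) fun i => thueMorse i = thueMorse (i + d)

/-- The number of factors of length `d + 1` with distinct first and last letters. -/
noncomputable def neEnds (d : ℕ) : ℕ :=
  windowCount (d + 1) fun i => thueMorse i ≠ thueMorse (i + d)

theorem eqEnds_two_mul {d : ℕ} (hd : 2 ≤ d) : eqEnds (2 * d) = 2 * eqEnds d := by
  rw [eqEnds, windowCount_two_mul_add_one hd, windowCount_congr eq_shift_even,
    windowCount_congr eq_shift_odd, ← eqEnds, two_mul]

theorem neEnds_two_mul {d : ℕ} (hd : 2 ≤ d) : neEnds (2 * d) = 2 * neEnds d := by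
  rw [neEnds, windowCount_two_mul_add_one hd,
    windowCount_congr fun j => not_congr (eq_shift_even j),
    windowCount_congr fun j => not_congr (eq_shift_odd j), ← neEnds, two_mul]

theorem eqEnds_two_mul_add_one {d : ℕ} (hd : 1 ≤ d) :
    eqEnds (2 * d + 1) = neEnds d + neEnds (d + 1) := by
  rw [eqEnds, show 2 * d + 1 + 1 = 2 * (d + 1) by ring, windowCount_two_mul (by omega),
    windowCount_congr eq_shift_odd_even, windowCount_congr eq_shift_odd_odd]
  rfl

theorem neEnds_two_mul_add_one {d : ℕ} (hd : 1 ≤ d) :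
    neEnds (2 * d + 1) = eqEnds d + eqEnds (d + 1) := by
  rw [neEnds, show 2 * d + 1 + 1 = 2 * (d + 1) by ring, windowCount_two_mul (by omega),
    windowCount_congr fun j => (not_congr (eq_shift_odd_even j)).trans not_not,
    windowCount_congr fun j => (not_congr (eq_shift_odd_odd j)).trans not_not]
  rfl

/-! Counts of short windows. -/

/-- The windows of length `N` at the first `48` positions, read off a finite prefix. -/
def prefixWindows (N : ℕ) (p : List (Fin 2) → Bool) : Finset (List (Fin 2)) :=
  (((List.range 48).map fun i => (((applySubst mu)^[6] [0]).drop i).take N).filter p).toFinset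

theorem take_drop_prefix {i N : ℕ} (hi : i < 48) (hN : N ≤ 9) :
    (((applySubst mu)^[6] [0]).drop i).take N = window thueMorse i N := by
  rw [iterate_eq_window]
  apply List.ext_getElem
  · simp [window]; omega
  · simp [window]

/-- Once the condition is read off the word itself, the first 48 positions suffice; this makes the
base cases decidable. -/
theorem windowCount_eq_card {N : ℕ} (hN : N ≤ 9) (P : ℕ → Prop) (p : List (Fin 2) → Bool)
    (h : ∀ i, P i ↔ p (window thueMorse i N) = true) :
    windowCount N P = (prefixWindows N p).card := by
  rw [windowCount, ← Set.ncard_coe_finset]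
  congr 1
  ext w
  simp only [prefixWindows, Set.mem_image, Set.mem_ofPred_eq, List.coe_toFinset, List.mem_filter,
    List.mem_map, List.mem_range, h]
  constructor
  · rintro ⟨i, hi, rfl⟩
    obtain ⟨j, hj, e⟩ := exists_window_eq i hN
    exact ⟨⟨j, hj, by rw [take_drop_prefix hj hN, e]⟩, hi⟩
  · rintro ⟨⟨j, hj, rfl⟩, hp⟩
    rw [take_drop_prefix hj hN] at hp ⊢
    exact ⟨j, hp, rfl⟩

theorem getD_window (i : ℕ) {N k : ℕ} (hk : k < N) :
    (window thueMorse i N).getD k 0 = thueMorse (i + k) := by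
  rw [List.getD_eq_getElem _ _ (by simpa [window] using hk)]
  simp [window]

theorem eqEnds_eq_card {d : ℕ} (hd : d ≤ 8) :
    eqEnds d = (prefixWindows (d + 1) fun w => w.getD 0 0 = w.getD d 0).card :=
  windowCount_eq_card (by omega) _ _ fun i => by
    simp [-List.getD_eq_getElem?_getD, getD_window]

theorem neEnds_eq_card {d : ℕ} (hd : d ≤ 8) :
    neEnds d = (prefixWindows (d + 1) fun w => w.getD 0 0 ≠ w.getD d 0).card :=
  windowCount_eq_card (by omega) _ _ fun i => by
    simp [-List.getD_eq_getElem?_getD, getD_window]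

/-! ### Closed forms at `2 ^ (k + 1)` and `4 ^ (n + 1) - 1` -/

theorem eqEnds_two_pow (k : ℕ) : eqEnds (2 ^ (k + 1)) = 2 * 2 ^ k := by
  induction k with
  | zero => rw [eqEnds_eq_card (by norm_num)]; decide +kernel
  | succ k ih =>
    rw [pow_succ', eqEnds_two_mul (by rw [pow_succ']; have := Nat.one_le_two_pow (n := k); omega),
      ih, pow_succ]
    ring

theorem neEnds_two_pow (k : ℕ) : neEnds (2 ^ (k + 1)) = 4 * 2 ^ k := by
  induction k with
  | zero => rw [neEnds_eq_card (by norm_num)]; decide +kernel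
  | succ k ih =>
    rw [pow_succ', neEnds_two_mul (by rw [pow_succ']; have := Nat.one_le_two_pow (n := k); omega),
      ih, pow_succ]
    ring

theorem three_mul_neEnds_four_pow_sub_one (n : ℕ) :
    3 * neEnds (4 ^ (n + 1) - 1) + 4 = 4 ^ (n + 2) := by
  induction n with
  | zero => rw [neEnds_eq_card (by norm_num)]; decide +kernel
  | succ n ih =>
    have h1 : 4 ≤ 4 ^ (n + 1) := by
      rw [pow_succ']; have := Nat.one_le_pow n 4 (by norm_num); omega
    have h2 : 4 ^ (n + 1) = 2 ^ (2 * n + 1 + 1) := by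
      rw [show 2 * n + 1 + 1 = 2 * (n + 1) by ring, pow_mul]; norm_num
    have h3 : 2 * 4 ^ (n + 1) = 2 ^ (2 * n + 2 + 1) := by rw [h2]; ring
    -- With `N = 4 ^ (n + 1)`, two odd recurrences give `neEnds (4N - 1) = neEnds (N - 1) + neEnds N
    -- + eqEnds (2N)`.
    rw [show 4 ^ (n + 1 + 1) - 1 = 2 * (2 * 4 ^ (n + 1) - 1) + 1 by rw [pow_succ' 4 (n + 1)]; omega,
      neEnds_two_mul_add_one (by omega),
      show 2 * 4 ^ (n + 1) - 1 + 1 = 2 * 4 ^ (n + 1) by omega,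
      show 2 * 4 ^ (n + 1) - 1 = 2 * (4 ^ (n + 1) - 1) + 1 by omega,
      eqEnds_two_mul_add_one (by omega),
      show 4 ^ (n + 1) - 1 + 1 = 4 ^ (n + 1) by omega, h3, eqEnds_two_pow]
    rw [show neEnds (4 ^ (n + 1)) = 4 * 2 ^ (2 * n + 1) by rw [h2, neEnds_two_pow]]
    have h4 : 2 ^ (2 * n) = 4 ^ n := by rw [pow_mul]; norm_num
    simp only [pow_succ, h4] at ih ⊢
    omega

/-! The factor complexity at `3 * 2 ^ k` and `3 * 2 ^ k + 1`. -/

/-- The number of factors of length `N`. -/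
noncomputable def complexity (N : ℕ) : ℕ := windowCount N fun _ => True

/-- Halving an even length `2M` yields both `M` and `M + 1`, so the two values go through one
induction. -/
theorem complexity_three_mul_two_pow (k : ℕ) :
    complexity (3 * 2 ^ k) + 4 = 10 * 2 ^ k ∧ complexity (3 * 2 ^ k + 1) = 10 * 2 ^ k := by
  induction k with
  | zero =>
    constructor <;>
    · rw [complexity, windowCount_eq_card (by norm_num) _ (fun _ => true) (by simp)]
      decide +kernel
  | succ k ih =>
    have := Nat.one_le_two_pow (n := k)
    rw [show 3 * 2 ^ (k + 1) = 2 * (3 * 2 ^ k) by ring, complexity, complexity,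
      windowCount_two_mul (by omega), windowCount_two_mul_add_one (by omega), ← complexity,
      ← complexity, pow_succ]
    omega

/-- The number of factors of length `2 * m + 1` whose first, middle and last letters agree. -/
noncomputable def eqThree (m : ℕ) : ℕ :=
  windowCount (2 * m + 1) fun i =>
    thueMorse i = thueMorse (i + m) ∧ thueMorse i = thueMorse (i + 2 * m)

theorem eqThree_two_mul {m : ℕ} (hm : 1 ≤ m) : eqThree (2 * m) = 2 * eqThree m := by
  rw [eqThree, windowCount_two_mul_add_one (by omega),
    windowCount_congr fun j => and_congr (eq_shift_even j) (eq_shift_even j),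
    windowCount_congr fun j => and_congr (eq_shift_odd j) (eq_shift_odd j), ← eqThree, two_mul]

theorem eqThree_three_mul_two_pow (k : ℕ) : eqThree (3 * 2 ^ k) = 8 * 2 ^ k := by
  induction k with
  | zero =>
    rw [eqThree, windowCount_eq_card (by norm_num) _
      (fun w => w.getD 0 0 = w.getD 3 0 ∧ w.getD 0 0 = w.getD 6 0)
      (fun i => by simp [-List.getD_eq_getElem?_getD, getD_window])]
    decide +kernel
  | succ k ih =>
    have := Nat.one_le_two_pow (n := k)
    rw [show 3 * 2 ^ (k + 1) = 2 * (3 * 2 ^ k) by ring, eqThree_two_mul (by omega), ih, pow_succ]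
    ring

/-! Abelian squares in terms of windows. -/

/-- The number of ones among the first `i` letters of the Thue-Morse word. -/
def onesBefore (i : ℕ) : ℕ := ∑ k ∈ Finset.range i, (thueMorse k : ℕ)

theorem onesBefore_two_mul (k : ℕ) : onesBefore (2 * k) = k := by
  induction k with
  | zero => rfl
  | succ k ih =>
    rw [onesBefore, mul_add, Finset.sum_range_succ, Finset.sum_range_succ, ← onesBefore, ih,
      thueMorse_two_mul, thueMorse_two_mul_add_one]
    have : ∀ a : Fin 2, (a : ℕ) + (1 - a : Fin 2) = 1 := by decide
    rw [add_assoc, this]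

theorem onesBefore_two_mul_add_one (k : ℕ) :
    onesBefore (2 * k + 1) = k + (thueMorse k : ℕ) := by
  rw [onesBefore, Finset.sum_range_succ, ← onesBefore, onesBefore_two_mul, thueMorse_two_mul]

theorem onesBefore_add (i n : ℕ) :
    onesBefore (i + n) = onesBefore i + (window thueMorse i n).count 1 := by
  induction n with
  | zero => simp [window]
  | succ n ih =>
    rw [window_add, List.count_append, ← add_assoc, ← add_assoc, ← ih, onesBefore,
      Finset.sum_range_succ, ← onesBefore]
    congr 1
    have : ∀ a : Fin 2, (a : ℕ) = [a].count 1 := by decide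
    simpa [window] using this _

theorem count_zero_add_count_one (w : List (Fin 2)) : w.count 0 + w.count 1 = w.length := by
  induction w with
  | nil => rfl
  | cons a w ih =>
    have : ∀ a : Fin 2, (if a == 0 then 1 else 0) + (if a == 1 then 1 else 0) = 1 := by decide
    have := this a
    rw [List.count_cons, List.count_cons, List.length_cons]
    omega

theorem parikh_eq_iff {u v : List (Fin 2)} :
    parikh u = parikh v ↔ u.length = v.length ∧ u.count 1 = v.count 1 := by
  rw [← count_zero_add_count_one, ← count_zero_add_count_one]
  simp only [parikh, funext_iff, Fin.forall_fin_two]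
  omega

theorem isAbelianSquare_window_iff {i n : ℕ} (hn : 1 ≤ n) :
    IsAbelianSquare (window thueMorse i (2 * n)) ↔
      onesBefore (i + 2 * n) + onesBefore i = 2 * onesBefore (i + n) := by
  have hw : window thueMorse i (2 * n) = window thueMorse i n ++ window thueMorse (i + n) n := by
    rw [two_mul, window_add]
  have h1 := onesBefore_add i n
  have h2 := onesBefore_add (i + n) n
  rw [add_assoc, ← two_mul] at h2
  constructor
  · rintro ⟨-, u, v, huv, hp⟩
    rw [parikh_eq_iff] at hp
    have hl := congrArg List.length huv
    rw [length_window, List.length_append] at hl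
    -- Equal Parikh vectors force equal lengths, so `u` and `v` are the two halves.
    obtain ⟨rfl, rfl⟩ := List.append_inj (hw.symm.trans huv) (by rw [length_window]; omega)
    omega
  · intro h
    refine ⟨fun h0 => ?_, _, _, hw, ?_⟩
    · have := congrArg List.length h0
      rw [length_window, List.length_nil] at this
      omega
    · rw [parikh_eq_iff, length_window, length_window]
      omega

theorem f_eq_windowCount {n : ℕ} (hn : 1 ≤ n) :
    f n = windowCount (2 * n) fun i =>
      onesBefore (i + 2 * n) + onesBefore i = 2 * onesBefore (i + n) := by
  rw [f, windowCount]
  congr 1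
  ext w
  constructor
  · rintro ⟨⟨i, hi⟩, ha, hl⟩
    rw [hl] at hi
    subst hi
    exact ⟨i, (isAbelianSquare_window_iff hn).1 ha, rfl⟩
  · rintro ⟨i, hi, rfl⟩
    exact ⟨⟨i, by simp only [length_window]⟩, (isAbelianSquare_window_iff hn).2 hi,
      length_window _ _ _⟩

theorem f_two_mul {m : ℕ} (hm : 1 ≤ m) : f (2 * m) = complexity (2 * m) + eqThree m := by
  rw [f_eq_windowCount (by omega), windowCount_two_mul (by omega), complexity, eqThree]
  congr 1
  · refine windowCount_congr fun j => iff_true_intro ?_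
    rw [← mul_add, ← mul_add, onesBefore_two_mul, onesBefore_two_mul, onesBefore_two_mul]
    omega
  · refine windowCount_congr fun j => ?_
    rw [show 2 * j + 1 + 2 * (2 * m) = 2 * (j + 2 * m) + 1 by ring,
      show 2 * j + 1 + 2 * m = 2 * (j + m) + 1 by ring, onesBefore_two_mul_add_one,
      onesBefore_two_mul_add_one, onesBefore_two_mul_add_one, Fin.ext_iff, Fin.ext_iff]
    omega

theorem f_two_mul_add_one {m : ℕ} (hm : 1 ≤ m) : f (2 * m + 1) = neEnds (2 * m + 1) := by
  rw [f_eq_windowCount (by omega), windowCount_two_mul (by omega)]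
  -- The left side is `2 * j + 2 * m + 1`, which is odd.
  have h0 : ∀ j, onesBefore (2 * j + 2 * (2 * m + 1)) + onesBefore (2 * j) =
      2 * onesBefore (2 * j + (2 * m + 1)) ↔ False := fun j => by
    rw [iff_false, ← mul_add,
      show 2 * j + (2 * m + 1) = 2 * (j + m) + 1 by ring, onesBefore_two_mul,
      onesBefore_two_mul, onesBefore_two_mul_add_one]
    omega
  rw [windowCount_congr h0, show windowCount (2 * m + 1) (fun _ => False) = 0 by simp [windowCount],
    zero_add, neEnds]
  refine windowCount_congr fun j => ?_
  rw [show 2 * j + 1 + 2 * (2 * m + 1) = 2 * (j + (2 * m + 1)) + 1 by ring,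
    show 2 * j + 1 + (2 * m + 1) = 2 * (j + m + 1) by ring, onesBefore_two_mul_add_one,
    onesBefore_two_mul_add_one, onesBefore_two_mul, Ne, Fin.ext_iff]
  omega

end AbelianSquares

/-! ### The two values of `f` -/

open AbelianSquares in
theorem mainTheorem5 (n : ℕ) (hn : 1 ≤ n) :
    (AbelianSquares.f (4 ^ n - 1) : ℚ) = (4 ^ (n + 1) - 4) / 3 ∧
      (AbelianSquares.f (3 * 2 ^ n) : ℚ) = 14 * 2 ^ n - 4 := by
  obtain ⟨k, rfl⟩ := Nat.exists_eq_add_of_le' hn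
  constructor
  · have h := three_mul_neEnds_four_pow_sub_one k
    have h4 : 1 ≤ 4 ^ k := Nat.one_le_pow k 4 (by norm_num)
    have hm : 4 ^ (k + 1) - 1 = 2 * (2 * 4 ^ k - 1) + 1 := by rw [pow_succ]; omega
    rw [hm, ← f_two_mul_add_one (by omega), ← hm] at h
    rw [eq_div_iff (by norm_num), eq_sub_iff_add_eq, mul_comm]
    exact_mod_cast h
  · have h1 := (complexity_three_mul_two_pow (k + 1)).1
    have h2 := eqThree_three_mul_two_pow k
    have h3 := f_two_mul (m := 3 * 2 ^ k) (by have := Nat.one_le_two_pow (n := k); omega)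
    have e : 2 * (3 * 2 ^ k) = 3 * 2 ^ (k + 1) := by ring
    rw [e] at h3
    have h : f (3 * 2 ^ (k + 1)) + 4 = 14 * 2 ^ (k + 1) := by
      rw [pow_succ] at *; omega
    rw [eq_sub_iff_add_eq]
    exact_mod_cast h
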